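/- A Fermat prime is a prime of the form $2^{2^k}+1$ with $k\ge 0$ (so $3$ and $5$ are Fermat primes), and a Mersenne prime is a prime of the form $2^k-1$. For a positive integer $x$, let $\mathrm{rad}(x)$ be the product of the distinct primes dividing $x$. (1) Let $p\neq q$ be primes, each of which is a Fermat prime or a Mersenne prime, let $m,n,r\ge 1$ be integers and let $\mu\in\{1,-1\}$. Then $$2^m+\mu=p^nq^r$$ holds if and only if, up to interchanging $(p,n)$ and $(q,r)$, it is one of the two identities $$2^6-1=3^2\cdot 7,\qquad 2^4-1=3\cdot 5 .$$ (2) In addition $2^9+1=3^3\cdot 19$, where $19$ is a prime that is neither a Fermat prime nor a Mersenne prime. In particular, every solution as in (1) occurs among the three identities $2^9+1=3^3\cdot 19$, $2^6-1=3^2\cdot 7$, $2^4-1=3\cdot 5$. (3) For each of these three identities, the corresponding triple $(A,B,C)=(1,\,2^9,\,3^3\cdot 19)$, $(1,\,3^2\cdot 7,\,2^6)$, $(1,\,3\cdot 5,\,2^4)$ satisfies $A+B=C$, $\gcd(A,B)=1$, $1\le A<B$ and $$\mathrm{rad}(ABC)>\sqrt{C}.$$ Moreover, whenever $C=PG^2+s$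 with $P$ an odd prime and $G,s$ positive integers with $1\le G^2<P$ and $1\le s\le PG^2-1$, one has $\mathrm{rad}(ABC)>\sqrt{2PG^2}>\sqrt{C}$. -/

import Mathlib

/-- `p` is a Fermat prime: a prime of the form `2 ^ (2 ^ k) + 1`, `k ≥ 0`. -/
def IsFermatPrime (p : ℕ) : Prop := p.Prime ∧ ∃ k : ℕ, p = Nat.fermatNumber k

/-- `p` is a Mersenne prime: a prime of the form `2 ^ k - 1`. -/
def IsMersennePrime (p : ℕ) : Prop := p.Prime ∧ ∃ k : ℕ, p = mersenne k

/-- An `ABC` triple: `A + B = C`, `gcd(A, B) = 1` and `B > A ≥ 1`. -/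
def IsABCTriple (A B C : ℕ) : Prop :=
  1 ≤ A ∧ A < B ∧ Nat.Coprime A B ∧ A + B = C

/-- `rad(ABC)`, the product of the distinct primes dividing `ABC`. -/
noncomputable def radABC (A B C : ℕ) : ℕ :=
  UniqueFactorizationMonoid.radical (A * B * C)

/-- The form of the `ABC` inequality with exponent `2`: whenever `C = P G² + s` with `P` an odd
prime, `1 ≤ G² < P` and `1 ≤ s ≤ P G² - 1`, one has `rad(ABC) > √(2 P G²) > √C`. -/
def SatisfiesPrimeSquareBound (A B C : ℕ) : Prop :=
  ∀ P G s : ℕ, P.Prime → Odd P → 1 ≤ G ^ 2 → G ^ 2 < P → 1 ≤ s → s < P * G ^ 2 →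
    C = P * G ^ 2 + s →
      √(2 * (P : ℝ) * (G : ℝ) ^ 2) < (radABC A B C : ℝ) ∧
        √(C : ℝ) < √(2 * (P : ℝ) * (G : ℝ) ^ 2)

/-! Everything rests on the order of 2: it is `a` modulo a Mersenne prime `mersenne a`, and `2 ^ (k
+ 1)` modulo `Nat.fermatNumber k`. For `2 ^ m + 1`, odd order excludes Mersenne primes other than 3,
and two distinct Fermat numbers require different powers of 2 in `m`. For `2 ^ m - 1`, lifting the
exponent gives `2 ^ m - 1 ∣ p * q * m`. A Fermat prime other than 3 forces `4 ∣ m`, hence `{p, q} =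
{3, 5}`; otherwise both primes are Mersenne, with `a * b ∣ m`. Either way `p * q` is small against
`2 ^ m`, so `m < 12`. For the triples, `2 * C ≤ rad ^ 2` is enough. -/

/-- A prime `p` dividing `2 ^ d - 1` exactly once divides `2 ^ m - 1` at most once more than it
divides `m`, for `d ∣ m`. -/
theorem pow_dvd_mul_of_pow_dvd_two_pow_sub_one {p d m n : ℕ} (hp : p.Prime) (hd : p ∣ 2 ^ d - 1)
    (hd2 : ¬ p ^ 2 ∣ 2 ^ d - 1) (hdm : d ∣ m) (hm : m ≠ 0) (h : p ^ n ∣ 2 ^ m - 1) :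
    p ^ n ∣ p * m := by
  have : Fact p.Prime := ⟨hp⟩
  obtain ⟨t, rfl⟩ := hdm
  have hd0 : d ≠ 0 := left_ne_zero_of_mul hm
  have ht0 : t ≠ 0 := right_ne_zero_of_mul hm
  have hd1 : 1 < 2 ^ d := Nat.one_lt_two_pow hd0
  have hp2 : ¬ p ∣ 2 ^ d := fun hc => hp.one_lt.ne' <| Nat.dvd_one.1 <| by
    have := Nat.dvd_sub hc hd
    rwa [Nat.sub_sub_self hd1.le] at this
  have hodd : Odd p := hp.odd_of_ne_two <| by
    rintro rfl
    exact hp2 (dvd_pow_self 2 hd0)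
  have key := padicValNat.pow_sub_pow (p := p) hodd hd1 hd hp2 ht0
  rw [one_pow, ← pow_mul] at key
  have hlt : padicValNat p (2 ^ d - 1) < 2 := by
    by_contra! hc
    exact hd2 ((padicValNat_dvd_iff_le (by omega)).2 hc)
  have hmt : 1 < 2 ^ (d * t) := Nat.one_lt_two_pow hm
  rw [padicValNat_dvd_iff_le (by omega), key] at h
  have hpt : p ^ n ∣ p * t := by
    rw [padicValNat_dvd_iff_le (mul_ne_zero hp.ne_zero ht0), padicValNat.mul hp.ne_zero ht0,
      padicValNat_self]
    omega
  exact hpt.trans (mul_dvd_mul_left p (dvd_mul_left t d))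

theorem two_pow_sub_one_dvd_mul {p q m n r d e : ℕ} (hp : p.Prime) (hq : q.Prime) (hpq : p ≠ q)
    (hm : m ≠ 0) (h : 2 ^ m - 1 = p ^ n * q ^ r)
    (hpd : p ∣ 2 ^ d - 1) (hpd2 : ¬ p ^ 2 ∣ 2 ^ d - 1) (hdm : d ∣ m)
    (hqe : q ∣ 2 ^ e - 1) (hqe2 : ¬ q ^ 2 ∣ 2 ^ e - 1) (hem : e ∣ m) :
    2 ^ m - 1 ∣ p * q * m := by
  have h1 := pow_dvd_mul_of_pow_dvd_two_pow_sub_one hp hpd hpd2 hdm hm (h ▸ dvd_mul_right _ _)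
  have h2 := pow_dvd_mul_of_pow_dvd_two_pow_sub_one hq hqe hqe2 hem hm (h ▸ dvd_mul_left _ _)
  rw [h]
  refine (Nat.Coprime.pow n r ((Nat.coprime_primes hp hq).2 hpq)).mul_dvd_of_dvd_of_dvd ?_ ?_
  · exact h1.trans ⟨q, by ring⟩
  · exact h2.trans ⟨p, by ring⟩

/-! ### Orders of 2 modulo Mersenne primes and Fermat numbers -/

theorem natCast_dvd_two_pow_sub_one_iff {p m : ℕ} :
    p ∣ 2 ^ m - 1 ↔ (2 : ZMod p) ^ m = 1 := by
  rw [← CharP.cast_eq_zero_iff (ZMod p) p, Nat.cast_sub Nat.one_le_two_pow, sub_eq_zero]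
  simp

theorem exponent_dvd_of_mersenne_dvd {a m : ℕ} (ha : a.Prime) (hp : (mersenne a).Prime)
    (h : mersenne a ∣ 2 ^ m - 1) : a ∣ m := by
  have : Fact a.Prime := ⟨ha⟩
  have : Fact (mersenne a).Prime := ⟨hp⟩
  have h2 : (2 : ZMod (mersenne a)) ^ a = 1 := natCast_dvd_two_pow_sub_one_iff.1 dvd_rfl
  rw [natCast_dvd_two_pow_sub_one_iff, ← orderOf_dvd_iff_pow_eq_one] at h
  rwa [orderOf_eq_prime h2] at h
  intro h1
  have : (1 : ZMod (mersenne a)) = 0 := by linear_combination h1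
  exact one_ne_zero this

theorem two_pow_two_pow_eq_neg_one (k : ℕ) :
    (2 : ZMod (Nat.fermatNumber k)) ^ 2 ^ k = -1 := by
  have : ((2 ^ 2 ^ k + 1 : ℕ) : ZMod (Nat.fermatNumber k)) = 0 :=
    CharP.cast_eq_zero _ (Nat.fermatNumber k)
  push_cast at this
  linear_combination this

/-- Since `2 ^ 2 ^ k = -1 ≠ 1`, the order of 2 is exactly `2 ^ (k + 1)`; primality plays no role. -/
theorem two_pow_succ_dvd_of_fermatNumber_dvd {k m : ℕ} (h : Nat.fermatNumber k ∣ 2 ^ m - 1) :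
    2 ^ (k + 1) ∣ m := by
  have : Fact (2 < Nat.fermatNumber k) := ⟨Nat.two_lt_fermatNumber k⟩
  have h2 := two_pow_two_pow_eq_neg_one k
  rw [natCast_dvd_two_pow_sub_one_iff, ← orderOf_dvd_iff_pow_eq_one] at h
  rwa [orderOf_eq_prime_pow (p := 2) (n := k)] at h
  · rw [h2]
    exact ZMod.neg_one_ne_one
  · rw [pow_succ, pow_mul, h2]
    norm_num

theorem fermatNumber_dvd_two_pow_sub_one {k m : ℕ} (h : 2 ^ (k + 1) ∣ m) :
    Nat.fermatNumber k ∣ 2 ^ m - 1 := by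
  obtain ⟨t, rfl⟩ := h
  rw [natCast_dvd_two_pow_sub_one_iff, pow_mul, pow_succ 2 k, pow_mul,
    two_pow_two_pow_eq_neg_one k]
  norm_num

/-! ### The equation with `2 ^ m + 1` -/

theorem natCast_dvd_two_pow_add_one_iff {p m : ℕ} :
    p ∣ 2 ^ m + 1 ↔ (2 : ZMod p) ^ m = -1 := by
  rw [← CharP.cast_eq_zero_iff (ZMod p) p, ← add_eq_zero_iff_eq_neg]
  simp

theorem IsMersennePrime.exists_exponent {p : ℕ} (h : IsMersennePrime p) :
    ∃ a : ℕ, a.Prime ∧ p = mersenne a := by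
  obtain ⟨hp, a, rfl⟩ := h
  exact ⟨a, hp.of_mersenne, rfl⟩

/-- Among Mersenne primes only `3`, which is also a Fermat prime, divides some `2 ^ m + 1`. -/
theorem isFermatPrime_of_dvd_two_pow_add_one {p m : ℕ} (hp : IsFermatPrime p ∨ IsMersennePrime p)
    (h : p ∣ 2 ^ m + 1) : IsFermatPrime p := by
  rcases hp with hp | hp
  · exact hp
  obtain ⟨a, ha, rfl⟩ := hp.exists_exponent
  rcases ha.eq_two_or_odd' with rfl | hodd
  · exact ⟨hp.1, 0, rfl⟩
  exfalso
  have h3 : 3 ≤ a := by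
    obtain ⟨t, rfl⟩ := hodd
    have := ha.two_le
    omega
  have h8 : mersenne 3 ≤ mersenne a := mersenne_le_mersenne.2 h3
  have : Fact (2 < mersenne a) := ⟨lt_of_lt_of_le (by decide) h8⟩
  have h2 : (2 : ZMod (mersenne a)) ^ a = 1 := natCast_dvd_two_pow_sub_one_iff.1 dvd_rfl
  rw [natCast_dvd_two_pow_add_one_iff] at h
  -- For odd `a`, `-1 = (-1) ^ a = (2 ^ m) ^ a = (2 ^ a) ^ m = 1`.
  apply ZMod.neg_one_ne_one (n := mersenne a)
  rw [← hodd.neg_one_pow, ← h, ← pow_mul, mul_comm, pow_mul, h2, one_pow]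

/-- The larger index gives `2 ^ (j + 1) ∣ 2 ^ k ∣ m`, so `2 ^ m` is 1 rather than -1 modulo the
smaller Fermat number. -/
theorem not_both_fermatNumber_dvd_two_pow_add_one {j k m : ℕ} (hjk : j < k)
    (hj : Nat.fermatNumber j ∣ 2 ^ m + 1) (hk : Nat.fermatNumber k ∣ 2 ^ m + 1) : False := by
  have : Fact (2 < Nat.fermatNumber j) := ⟨Nat.two_lt_fermatNumber j⟩
  rw [natCast_dvd_two_pow_add_one_iff] at hj hk
  have h2m : Nat.fermatNumber k ∣ 2 ^ (m * 2) - 1 := by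
    rw [natCast_dvd_two_pow_sub_one_iff, pow_mul, hk]
    norm_num
  have hkm : 2 ^ k ∣ m := by
    have := two_pow_succ_dvd_of_fermatNumber_dvd h2m
    rw [pow_succ] at this
    exact Nat.dvd_of_mul_dvd_mul_right two_pos this
  have hjm := natCast_dvd_two_pow_sub_one_iff.1
    (fermatNumber_dvd_two_pow_sub_one ((pow_dvd_pow 2 (Nat.succ_le_of_lt hjk)).trans hkm))
  exact ZMod.neg_one_ne_one (hj.symm.trans hjm)

theorem two_pow_add_one_ne {p q m n r : ℕ} (hp : IsFermatPrime p ∨ IsMersennePrime p)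
    (hq : IsFermatPrime q ∨ IsMersennePrime q) (hpq : p ≠ q) (hn : n ≠ 0) (hr : r ≠ 0) :
    2 ^ m + 1 ≠ p ^ n * q ^ r := by
  intro h
  have hpm : p ∣ 2 ^ m + 1 := h ▸ (dvd_pow_self p hn).mul_right _
  have hqm : q ∣ 2 ^ m + 1 := h ▸ (dvd_pow_self q hr).mul_left _
  obtain ⟨-, j, rfl⟩ := isFermatPrime_of_dvd_two_pow_add_one hp hpm
  obtain ⟨-, k, rfl⟩ := isFermatPrime_of_dvd_two_pow_add_one hq hqm
  rcases lt_trichotomy j k with hjk | rfl | hjk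
  · exact not_both_fermatNumber_dvd_two_pow_add_one hjk hpm hqm
  · exact hpq rfl
  · exact not_both_fermatNumber_dvd_two_pow_add_one hjk hqm hpm

/-! ### The equation with `2 ^ m - 1` -/

theorem eq_or_eq_of_prime_dvd_pow_mul_pow {l p q n r : ℕ} (hl : l.Prime) (hp : p.Prime)
    (hq : q.Prime) (h : l ∣ p ^ n * q ^ r) : l = p ∨ l = q :=
  (hl.dvd_mul.1 h).imp (fun h => (Nat.prime_dvd_prime_iff_eq hl hp).1 (hl.dvd_of_dvd_pow h))
    (fun h => (Nat.prime_dvd_prime_iff_eq hl hq).1 (hl.dvd_of_dvd_pow h))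

theorem sixteen_mul_sq_add_two_lt_two_pow {m : ℕ} (hm : 12 ≤ m) : 16 * m ^ 2 + 2 < 2 ^ m := by
  induction m, hm using Nat.le_induction with
  | base => norm_num
  | succ m hm ih =>
    rw [pow_succ 2 m]
    nlinarith

theorem two_pow_sub_one_eq_three_pow_mul_five_pow {m n r : ℕ} (hm : 4 ∣ m) (hm0 : m ≠ 0)
    (h : 2 ^ m - 1 = 3 ^ n * 5 ^ r) : m = 4 ∧ n = 1 ∧ r = 1 := by
  have hdvd := two_pow_sub_one_dvd_mul (d := 2) (e := 4) Nat.prime_three Nat.prime_five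
    (by norm_num) hm0 h (by norm_num) (by norm_num) (dvd_trans (by norm_num) hm)
    (by norm_num) (by norm_num) hm
  have hle := Nat.le_of_dvd (by positivity) hdvd
  have hlt : m < 12 := by
    by_contra! hc
    have := sixteen_mul_sq_add_two_lt_two_pow hc
    have : 15 * m ≤ 16 * m ^ 2 := by nlinarith
    omega
  -- The other candidate `m = 8` fails by size: `255 > 15 * 8`.
  obtain rfl : m = 4 := by
    interval_cases m <;> omega
  have h15 : 3 ^ n * 5 ^ r = 15 := h.symm
  have hn : n < 3 := by
    by_contra! hc
    have := (pow_dvd_pow 3 hc).trans (h15 ▸ dvd_mul_right _ _)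
    norm_num at this
  have hr : r < 2 := by
    by_contra! hc
    have := (pow_dvd_pow 5 hc).trans (h15 ▸ dvd_mul_left _ _)
    norm_num at this
  interval_cases n <;> interval_cases r <;> simp_all

theorem two_pow_sub_one_eq_three_pow_mul_seven_pow {n r : ℕ}
    (h : 2 ^ 6 - 1 = 3 ^ n * 7 ^ r) : n = 2 ∧ r = 1 := by
  have h63 : 3 ^ n * 7 ^ r = 63 := h.symm
  have hn : n < 3 := by
    by_contra! hc
    have := (pow_dvd_pow 3 hc).trans (h63 ▸ dvd_mul_right _ _)
    norm_num at this
  have hr : r < 2 := by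
    by_contra! hc
    have := (pow_dvd_pow 7 hc).trans (h63 ▸ dvd_mul_left _ _)
    norm_num at this
  interval_cases n <;> interval_cases r <;> simp_all

theorem two_pow_sub_one_eq_mersenne_pow_mul_mersenne_pow {a b m n r : ℕ} (hab : a < b)
    (ha : a.Prime) (hb : b.Prime) (hpa : (mersenne a).Prime) (hpb : (mersenne b).Prime)
    (hm0 : m ≠ 0) (hn : n ≠ 0) (hr : r ≠ 0) (h : 2 ^ m - 1 = mersenne a ^ n * mersenne b ^ r) :
    m = 6 ∧ a = 2 ∧ n = 2 ∧ b = 3 ∧ r = 1 := by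
  have not_sq_dvd : ∀ c : ℕ, (mersenne c).Prime → ¬ mersenne c ^ 2 ∣ 2 ^ c - 1 := fun c hc hd => by
    have := Nat.le_of_dvd hc.pos hd
    nlinarith [hc.two_le]
  have ham : a ∣ m := exponent_dvd_of_mersenne_dvd ha hpa (h ▸ (dvd_pow_self _ hn).mul_right _)
  have hbm : b ∣ m := exponent_dvd_of_mersenne_dvd hb hpb (h ▸ (dvd_pow_self _ hr).mul_left _)
  have habm : a * b ∣ m :=
    ((Nat.coprime_primes ha hb).2 hab.ne).mul_dvd_of_dvd_of_dvd ham hbm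
  have hdvd := two_pow_sub_one_dvd_mul hpa hpb (strictMono_mersenne hab).ne hm0 h
    dvd_rfl (not_sq_dvd a hpa) ham dvd_rfl (not_sq_dvd b hpb) hbm
  have hle := Nat.le_of_dvd
    (Nat.mul_pos (Nat.mul_pos hpa.pos hpb.pos) (Nat.pos_of_ne_zero hm0)) hdvd
  have habm' := Nat.le_of_dvd (Nat.pos_of_ne_zero hm0) habm
  have h2a := ha.two_le
  have hlt : m < 12 := by
    by_contra! hc
    have hbig := sixteen_mul_sq_add_two_lt_two_pow hc
    -- This is `(a - 2) * (b - 2) ≥ 0` combined with `a * b ≤ m`. Squaring below avoids halving `m`.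
    have hexp : (a + b) * 2 ≤ m + 4 := by nlinarith
    have hsq : (2 ^ (a + b)) ^ 2 ≤ 2 ^ m * 16 := by
      rw [← pow_mul, show (16 : ℕ) = 2 ^ 4 by norm_num, ← pow_add]
      exact Nat.pow_le_pow_right two_pos hexp
    have hle' : 2 ^ m - 1 ≤ 2 ^ (a + b) * m := hle.trans <| by
      rw [pow_add]
      exact Nat.mul_le_mul_right _ (Nat.mul_le_mul (Nat.sub_le _ _) (Nat.sub_le _ _))
    have hle2 := Nat.pow_le_pow_left hle' 2
    rw [mul_pow] at hle2
    have hfin := hle2.trans (Nat.mul_le_mul_right (m ^ 2) hsq)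
    generalize 2 ^ m = X at hbig hfin
    obtain ⟨Y, rfl⟩ : ∃ Y, X = Y + 1 := ⟨X - 1, by omega⟩
    rw [Nat.add_sub_cancel] at hfin
    -- With `X = 2 ^ m`, `16 * m ^ 2 * X < (X - 2) * X < (X - 1) ^ 2`, contradicting `hfin`.
    nlinarith
  have hb6 : b < 6 := by nlinarith
  have ha4 : a < 4 := by nlinarith
  interval_cases a <;> interval_cases b <;> try omega
  · obtain rfl : m = 6 := by omega
    have := two_pow_sub_one_eq_three_pow_mul_seven_pow h
    omega
  · exact absurd hb (by norm_num)
  · obtain rfl : m = 10 := by omega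
    norm_num [mersenne] at hle

theorem eq_three_and_five_of_fermatNumber_dvd {p q m n r k : ℕ} (hp : p.Prime) (hq : q.Prime)
    (hm0 : m ≠ 0) (hk : k ≠ 0) (h : 2 ^ m - 1 = p ^ n * q ^ r)
    (hkm : Nat.fermatNumber k ∣ 2 ^ m - 1) :
    m = 4 ∧ ((p = 3 ∧ n = 1 ∧ q = 5 ∧ r = 1) ∨ (p = 5 ∧ n = 1 ∧ q = 3 ∧ r = 1)) := by
  have hm : 2 ^ (1 + 1) ∣ m :=
    (pow_dvd_pow 2 (by omega)).trans (two_pow_succ_dvd_of_fermatNumber_dvd hkm)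
  have h5 : 5 ∣ 2 ^ m - 1 := fermatNumber_dvd_two_pow_sub_one hm
  have h3 : 3 ∣ 2 ^ m - 1 := fermatNumber_dvd_two_pow_sub_one ((pow_dvd_pow 2 one_le_two).trans hm)
  rw [h] at h3 h5
  rcases eq_or_eq_of_prime_dvd_pow_mul_pow Nat.prime_three hp hq h3 with rfl | rfl <;>
  rcases eq_or_eq_of_prime_dvd_pow_mul_pow Nat.prime_five hp hq h5 with h5' | h5'
  · omega
  · subst h5'
    have := two_pow_sub_one_eq_three_pow_mul_five_pow hm hm0 h
    omega
  · subst h5'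
    have := two_pow_sub_one_eq_three_pow_mul_five_pow hm hm0 (h.trans (mul_comm _ _))
    omega
  · omega

/-- The prime 3 is counted as Mersenne, so the Fermat case has `k ≥ 1` and yields `4 ∣ m`. -/
theorem exists_fermatNumber_or_exists_mersenne {p : ℕ} (h : IsFermatPrime p ∨ IsMersennePrime p) :
    (∃ k, k ≠ 0 ∧ p = Nat.fermatNumber k) ∨ ∃ a : ℕ, a.Prime ∧ p = mersenne a := by
  rcases h with ⟨-, k, rfl⟩ | h
  · rcases eq_or_ne k 0 with rfl | hk
    · exact .inr ⟨2, Nat.prime_two, rfl⟩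
    · exact .inl ⟨k, hk, rfl⟩
  · exact .inr h.exists_exponent

theorem solutions_of_two_pow_sub_one_eq {p q m n r : ℕ} (hp : IsFermatPrime p ∨ IsMersennePrime p)
    (hq : IsFermatPrime q ∨ IsMersennePrime q) (hpq : p ≠ q) (hm : m ≠ 0) (hn : n ≠ 0)
    (hr : r ≠ 0) (h : 2 ^ m - 1 = p ^ n * q ^ r) :
    (m = 6 ∧ ((p = 3 ∧ n = 2 ∧ q = 7 ∧ r = 1) ∨ (p = 7 ∧ n = 1 ∧ q = 3 ∧ r = 2))) ∨
      (m = 4 ∧ ((p = 3 ∧ n = 1 ∧ q = 5 ∧ r = 1) ∨ (p = 5 ∧ n = 1 ∧ q = 3 ∧ r = 1))) := by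
  have hpp : p.Prime := hp.elim And.left And.left
  have hqp : q.Prime := hq.elim And.left And.left
  have hpm : p ∣ 2 ^ m - 1 := h ▸ (dvd_pow_self p hn).mul_right _
  have hqm : q ∣ 2 ^ m - 1 := h ▸ (dvd_pow_self q hr).mul_left _
  rcases exists_fermatNumber_or_exists_mersenne hp with ⟨k, hk, hpk⟩ | ⟨a, ha, rfl⟩
  · exact .inr (eq_three_and_five_of_fermatNumber_dvd hpp hqp hm hk h (hpk ▸ hpm))
  rcases exists_fermatNumber_or_exists_mersenne hq with ⟨k, hk, hqk⟩ | ⟨b, hb, rfl⟩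
  · exact .inr (eq_three_and_five_of_fermatNumber_dvd hpp hqp hm hk h (hqk ▸ hqm))
  left
  rcases lt_trichotomy a b with hab | rfl | hab
  · obtain ⟨rfl, rfl, rfl, rfl, rfl⟩ :=
      two_pow_sub_one_eq_mersenne_pow_mul_mersenne_pow hab ha hb hpp hqp hm hn hr h
    exact ⟨rfl, .inl ⟨rfl, rfl, rfl, rfl⟩⟩
  · exact absurd rfl hpq
  · obtain ⟨rfl, rfl, rfl, rfl, rfl⟩ := two_pow_sub_one_eq_mersenne_pow_mul_mersenne_pow hab hb ha
      hqp hpp hm hr hn (h.trans (mul_comm _ _))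
    exact ⟨rfl, .inr ⟨rfl, rfl, rfl, rfl⟩⟩

/-! ### The prime 19 and the radical bounds -/

theorem not_isFermatPrime_nineteen : ¬ IsFermatPrime 19 := by
  rintro ⟨-, k, hk⟩
  rcases Nat.lt_or_ge k 3 with h | h
  · interval_cases k <;> simp [Nat.fermatNumber] at hk
  · have := Nat.fermatNumber_mono h
    rw [← hk] at this
    norm_num [Nat.fermatNumber] at this

theorem not_isMersennePrime_nineteen : ¬ IsMersennePrime 19 := by
  rintro ⟨-, k, hk⟩
  rcases Nat.lt_or_ge k 5 with h | h
  · interval_cases k <;> simp [mersenne] at hk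
  · have := mersenne_le_mersenne.2 h
    rw [← hk] at this
    norm_num [mersenne] at this

/-- From `1 ≤ s < P * G ^ 2` one gets `C < 2 * P * G ^ 2 < 2 * C ≤ rad ^ 2`. -/
theorem sqrt_lt_radABC_and_satisfiesPrimeSquareBound {A B C : ℕ}
    (h : 2 * C ≤ radABC A B C ^ 2) (hC : 0 < C) :
    √(C : ℝ) < (radABC A B C : ℝ) ∧ SatisfiesPrimeSquareBound A B C := by
  have h' : 2 * (C : ℝ) ≤ (radABC A B C : ℝ) ^ 2 := by exact_mod_cast h
  have hC' : (0 : ℝ) < C := by exact_mod_cast hC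
  have hR : 0 < (radABC A B C : ℝ) := by
    rcases (Nat.cast_nonneg (α := ℝ) (radABC A B C)).lt_or_eq with hR | hR
    · exact hR
    · rw [← hR] at h'
      linarith
  refine ⟨(Real.sqrt_lt' hR).2 (by linarith), fun P G s _ _ _ _ hs hs' hCs => ?_⟩
  have hsR : (1 : ℝ) ≤ s := by exact_mod_cast hs
  have hsR' : (s : ℝ) < P * G ^ 2 := by exact_mod_cast hs'
  have hCR : (C : ℝ) = P * G ^ 2 + s := by exact_mod_cast hCs
  exact ⟨(Real.sqrt_lt' hR).2 (by linarith), Real.sqrt_lt_sqrt hC'.le (by linarith)⟩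

theorem prod_dvd_radABC {A B C : ℕ} (s : Finset ℕ) (hs : ∀ p ∈ s, p.Prime ∧ p ∣ A * B * C)
    (h0 : A * B * C ≠ 0) : ∏ p ∈ s, p ∣ radABC A B C := by
  refine Finset.prod_primes_dvd _ (fun p hp => (hs p hp).1.prime) fun p hp => ?_
  exact (UniqueFactorizationMonoid.dvd_radical_iff_of_irreducible (hs p hp).1.prime.irreducible
    h0).2 (hs p hp).2

/-- Known prime divisors bound the radical from below, so it need not be computed. -/
theorem le_radABC_sq {A B C N : ℕ} (s : Finset ℕ) (hs : ∀ p ∈ s, p.Prime ∧ p ∣ A * B * C)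
    (h0 : A * B * C ≠ 0) (hN : N ≤ (∏ p ∈ s, p) ^ 2) : N ≤ radABC A B C ^ 2 :=
  hN.trans <| Nat.pow_le_pow_left
    (Nat.le_of_dvd (Nat.pos_of_ne_zero UniqueFactorizationMonoid.radical_ne_zero)
      (prod_dvd_radABC s hs h0)) 2

theorem mainTheorem1 :
    -- all solutions in distinct Fermat or Mersenne primes
    (∀ (p q m n r : ℕ) (μ : ℤ),
      (IsFermatPrime p ∨ IsMersennePrime p) → (IsFermatPrime q ∨ IsMersennePrime q) → p ≠ q →
      1 ≤ m → 1 ≤ n → 1 ≤ r → (μ = 1 ∨ μ = -1) →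
      ((2 : ℤ) ^ m + μ = (p : ℤ) ^ n * (q : ℤ) ^ r ↔
        (m = 6 ∧ μ = -1 ∧
          ((p = 3 ∧ n = 2 ∧ q = 7 ∧ r = 1) ∨ (p = 7 ∧ n = 1 ∧ q = 3 ∧ r = 2))) ∨
        (m = 4 ∧ μ = -1 ∧
          ((p = 3 ∧ n = 1 ∧ q = 5 ∧ r = 1) ∨ (p = 5 ∧ n = 1 ∧ q = 3 ∧ r = 1))))) ∧
    -- the further solution with `q = 19`, a prime that is neither Fermat nor Mersenne
    ((2 : ℤ) ^ 9 + 1 = 3 ^ 3 * 19 ∧ Nat.Prime 19 ∧ ¬ IsFermatPrime 19 ∧ ¬ IsMersennePrime 19) ∧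
    -- the inequality `rad(ABC) > √C` for the triples of all three identities
    (∀ A B C : ℕ,
      ((A, B, C) = (1, 2 ^ 9, 3 ^ 3 * 19) ∨ (A, B, C) = (1, 3 ^ 2 * 7, 2 ^ 6) ∨
        (A, B, C) = (1, 3 * 5, 2 ^ 4)) →
      IsABCTriple A B C ∧ √(C : ℝ) < (radABC A B C : ℝ) ∧ SatisfiesPrimeSquareBound A B C) := by
  refine ⟨fun p q m n r μ hp hq hpq hm hn hr hμ => ⟨fun h => ?_, ?_⟩,
    ⟨by norm_num, by norm_num, not_isFermatPrime_nineteen, not_isMersennePrime_nineteen⟩, ?_⟩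
  · rcases hμ with rfl | rfl
    · exact absurd (by exact_mod_cast h)
        (two_pow_add_one_ne (m := m) hp hq hpq (Nat.ne_of_gt hn) (Nat.ne_of_gt hr))
    · have hnat : 2 ^ m - 1 = p ^ n * q ^ r := by
        zify [Nat.one_le_two_pow (n := m)]
        linarith
      have := solutions_of_two_pow_sub_one_eq hp hq hpq (Nat.ne_of_gt hm) (Nat.ne_of_gt hn)
        (Nat.ne_of_gt hr) hnat
      simpa using this
  · rintro (⟨rfl, rfl, ⟨rfl, rfl, rfl, rfl⟩ | ⟨rfl, rfl, rfl, rfl⟩⟩ |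
      ⟨rfl, rfl, ⟨rfl, rfl, rfl, rfl⟩ | ⟨rfl, rfl, rfl, rfl⟩⟩) <;> norm_num
  · rintro A B C (h | h | h) <;> obtain ⟨rfl, rfl, rfl⟩ := by simpa only [Prod.mk.injEq] using h
    · exact ⟨by norm_num [IsABCTriple], sqrt_lt_radABC_and_satisfiesPrimeSquareBound
        (le_radABC_sq {2, 3, 19} (by norm_num) (by norm_num) (by norm_num)) (by norm_num)⟩
    · exact ⟨by norm_num [IsABCTriple], sqrt_lt_radABC_and_satisfiesPrimeSquareBound
        (le_radABC_sq {2, 3, 7} (by norm_num) (by norm_num) (by norm_num)) (by norm_num)⟩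
    · exact ⟨by norm_num [IsABCTriple], sqrt_lt_radABC_and_satisfiesPrimeSquareBound
        (le_radABC_sq {2, 3, 5} (by norm_num) (by norm_num) (by norm_num)) (by norm_num)⟩
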